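/- Let $G=(V,E)$ be a finite simple connected graph with adjacency matrix $(a_{ij})_{i,j\in V}$, and let $|G\rangle=\prod_{\{v,w\}\in E}\mathrm{CZ}^{\{vw\}}\,|+\rangle^{\otimes V}$ be its graph state, where $|+\rangle=\frac1{\sqrt2}(|0\rangle+|1\rangle)$ and $\mathrm{CZ}^{\{vw\}}$ is the controlled-$Z$ operator on the qubits $v,w$, that is, $\mathrm{CZ}^{\{vw\}}|x\rangle=(-1)^{x_vx_w}|x\rangle$ for $x\in\{0,1\}^V$. The foliage partition $\hat V$ of $G$ is the set of equivalence classes of the equivalence relation on $V$ for which $v\sim w$ if and only if $v$ and $w$ lie in the same connected component of $G$ and $a_{v,u_1}a_{w,u_2}=a_{v,u_2}a_{w,u_1}$ for all $u_1,u_2\in V\setminus\{v,w\}$; it is trivial if $\hat V=\{\{v\}\mid v\in V\}$. For $A\subseteq V$ let $\rho_A=\operatorname{tr}_{V\setminus A}|G\rangle\langle G|$ be the marginal of $|G\rangle$ on $A$; it is called maximally mixed if it is proportional to the identity. The state $|G\rangle$ is $2$-uniform if $\rho_A$ is maximally mixed for every $A\subseteq V$ with $|A|=2$. (1) For any two distinct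 vertices $v,w\in V$, the marginal $\rho_{\{v,w\}}$ is maximally mixed if and only if $v$ and $w$ belong to different parts of the foliage partition $\hat V$. (2) The state $|G\rangle$ is $2$-uniform if and only if the foliage partition $\hat V$ is trivial; equivalently, $|G\rangle$ is $2$-uniform if and only if $|\hat V|=|V|$. -/

import Mathlib

noncomputable section

/-! ### The foliage partition of a graph -/

section Foliage

variable {V : Type*} (G : SimpleGraph V) [DecidableRel G.Adj]

/-- The foliage relation: `v ∼ w` iff `v` and `w` lie in the same connected component of `G` and
`a_{v u₁} a_{w u₂} = a_{v u₂} a_{w u₁}` for any other vertices `u₁, u₂`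
(that is, neither of them is `v` or `w`), where `(a_{ij})` is the adjacency matrix. -/
def FoliageRel (v w : V) : Prop :=
  G.Reachable v w ∧
    ∀ u₁ u₂ : V, u₁ ≠ v → u₁ ≠ w → u₂ ≠ v → u₂ ≠ w →
      G.adjMatrix ℤ v u₁ * G.adjMatrix ℤ w u₂ = G.adjMatrix ℤ v u₂ * G.adjMatrix ℤ w u₁

/-- For distinct vertices: they are twins, or one of them has no further neighbour. -/
theorem foliageRel_cases {v w : V} (h : FoliageRel G v w) :
    (∀ u, u ≠ v → u ≠ w → (G.Adj v u ↔ G.Adj w u)) ∨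
    (∀ u, u ≠ v → u ≠ w → ¬ G.Adj v u) ∨ (∀ u, u ≠ v → u ≠ w → ¬ G.Adj w u) := by
  have h2 := h.2
  simp only [SimpleGraph.adjMatrix_apply] at h2
  by_contra! hc
  obtain ⟨⟨u, huv, huw, hu⟩, ⟨x, hxv, hxw, hx⟩, ⟨y, hyv, hyw, hy⟩⟩ := hc
  have h3 := h2 x y hxv hxw hyv hyw
  have h4 := h2 u y huv huw hyv hyw
  have h5 := h2 u x huv huw hxv hxw
  grind

/-- A vertex from which a different vertex can be reached has a neighbour. -/
theorem exists_adj_of_reachable {V : Type*} (G : SimpleGraph V) {v w : V} (h : G.Reachable v w) (hne : v ≠ w) :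
    ∃ u, G.Adj v u := by
  obtain ⟨p⟩ := h
  cases p with
  | nil => exact absurd rfl hne
  | cons h _ => exact ⟨_, h⟩

theorem foliageRel_equivalence : Equivalence (FoliageRel G) where
  refl v := ⟨SimpleGraph.Reachable.refl v, fun _ _ _ _ _ _ => mul_comm _ _⟩
  symm {v w} h := ⟨h.1.symm, fun u₁ u₂ h1 h2 h3 h4 => by
    have := h.2 u₁ u₂ h2 h1 h4 h3
    linarith⟩
  trans {v w x} h1 h2 := by
    refine ⟨h1.1.trans h2.1, ?_⟩
    by_cases hvw : v = w
    · subst hvw; exact h2.2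
    by_cases hwx : w = x
    · subst hwx; exact h1.2
    by_cases hvx : v = x
    · subst hvx; exact fun _ _ _ _ _ _ => mul_comm _ _
    obtain ⟨a, ha⟩ := exists_adj_of_reachable G h1.1 hvw
    obtain ⟨b, hb⟩ := exists_adj_of_reachable G h2.1 hwx
    obtain ⟨c, hc⟩ := exists_adj_of_reachable G h2.1.symm (Ne.symm hwx)
    have key : (∀ u, u ≠ v → u ≠ x → (G.Adj v u ↔ G.Adj x u)) ∨
        (∀ u, u ≠ v → u ≠ x → ¬ G.Adj v u) ∨ (∀ u, u ≠ v → u ≠ x → ¬ G.Adj x u) := by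
      have e1 := G.adj_comm v w
      have e2 := G.adj_comm w x
      have e3 := G.adj_comm v x
      have aw : a = w ∨ (a ≠ w ∧ a ≠ v) := by have := ha.ne; tauto
      have bv : b = v ∨ (b ≠ v ∧ b ≠ w) := by have := hb.ne; tauto
      have bx : b = x ∨ (b ≠ x ∧ b ≠ w) := by have := hb.ne; tauto
      have cw : c = w ∨ (c ≠ w ∧ c ≠ x) := by have := hc.ne; tauto
      have nvw := Ne.symm hvw
      have nwx := Ne.symm hwx
      have nvx := Ne.symm hvx
      rcases foliageRel_cases G h1 with h | h | h <;>
        rcases foliageRel_cases G h2 with h' | h' | h'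
      · left; intro u _ _; have := h u; have := h' u; have := h x; have := h' v; by_cases huw : u = w <;> grind
      · right; left; intro u _ _; have := h u; have := h' u; have := h' v; by_cases huw : u = w <;> grind
      · have := h' c; have := h x; have := h' v; grind
      · have := h a; have := h' v; grind
      · have := h a; have := h' v; grind
      · left; intro u _ _; have := h a; have := h' c; have := h u; have := h' u; by_cases huw : u = w <;> grind
      · right; right; intro u _ _; have := h u; have := h' u; have := h x; by_cases huw : u = w <;> grind
      · have := h b; have := h' b; grind
      · have := h x; have := h' c; grind
    intro u₁ u₂ k1 k2 k3 k4
    simp only [SimpleGraph.adjMatrix_apply]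
    grind

/-- The foliage relation as an equivalence relation on the vertices. -/
def foliageSetoid : Setoid V := ⟨FoliageRel G, foliageRel_equivalence G⟩

/-- The foliage partition: the set of equivalence classes of the foliage relation. -/
def foliagePartition : Set (Set V) := (foliageSetoid G).classes

/-- The foliage partition is trivial if it consists of the singletons `{v}`, `v ∈ V`. -/
def FoliageTrivial : Prop := foliagePartition G = Set.range (fun v : V => ({v} : Set V))

end Foliage

/-! ### Qubit states indexed by a finite set, graph states, marginals -/

section States

variable {V : Type*} [Fintype V] [DecidableEq V]

/-- A vector of the `V`-fold tensor power of `ℂ²`, given by its coefficients in the computational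
basis `|x⟩`, `x : V → {0, 1}`. -/
abbrev QubitVector (V : Type*) : Type _ := (V → Fin 2) → ℂ

/-- The one-qubit state `|+⟩ = (|0⟩ + |1⟩) / √2`. -/
def ketPlus : Fin 2 → ℂ :=
  ((1 / Real.sqrt 2 : ℝ) : ℂ) • (Pi.single 0 1 + Pi.single 1 1)

/-- The product vector `|φ⟩^{⊗ V}`. -/
def tensorPow (φ : Fin 2 → ℂ) : QubitVector V := fun x => ∏ v, φ (x v)

/-- The controlled-`Z` operator on the qubits `v` and `w` (identity on the other qubits): it
multiplies the basis vector `|x⟩` by `(-1) ^ (x_v x_w)`. -/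
def controlledZ (v w : V) : Matrix (V → Fin 2) (V → Fin 2) ℂ :=
  Matrix.diagonal fun x => (-1 : ℂ) ^ ((x v : ℕ) * (x w : ℕ))

/-- The controlled-`Z` operator of an unordered pair of qubits. -/
def controlledZEdge : Sym2 V → Matrix (V → Fin 2) (V → Fin 2) ℂ :=
  Sym2.lift ⟨controlledZ, fun v w => by simp only [controlledZ, mul_comm]⟩

theorem controlledZEdge_commute (e f : Sym2 V) :
    Commute (controlledZEdge e) (controlledZEdge f) := by
  induction e using Sym2.ind with
  | _ a b =>
    induction f using Sym2.ind with
    | _ c d =>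
      simp only [controlledZEdge, Sym2.lift_mk, controlledZ, Commute, SemiconjBy,
        Matrix.diagonal_mul_diagonal, mul_comm]

/-- The graph state `|G⟩ = ∏_{vw ∈ E} CZ^{vw} |+⟩^{⊗ V}`. -/
def graphState (G : SimpleGraph V) [DecidableRel G.Adj] : QubitVector V :=
  (G.edgeFinset.noncommProd controlledZEdge
    (fun e _ f _ _ => controlledZEdge_commute e f)).mulVec (tensorPow ketPlus)

/-- The density matrix `|ψ⟩⟨ψ|`. -/
def densityMatrix (ψ : QubitVector V) : Matrix (V → Fin 2) (V → Fin 2) ℂ :=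
  Matrix.vecMulVec ψ (star ψ)

/-- The assignment on `V` given by `a` on `A` and by `c` on the complement of `A`. -/
def glue (A : Finset V) (a : {v // v ∈ A} → Fin 2) (c : {v // v ∉ A} → Fin 2) : V → Fin 2 :=
  fun v => if h : v ∈ A then a ⟨v, h⟩ else c ⟨v, h⟩

/-- The partial trace over all the qubits outside of `A`. -/
def partialTraceCompl (A : Finset V) (ρ : Matrix (V → Fin 2) (V → Fin 2) ℂ) :
    Matrix ({v // v ∈ A} → Fin 2) ({v // v ∈ A} → Fin 2) ℂ :=
  Matrix.of fun a b => ∑ c : {v // v ∉ A} → Fin 2, ρ (glue A a c) (glue A b c)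

/-- The marginal (reduced density matrix) of `|ψ⟩` on the qubits in `A`. -/
def marginal (ψ : QubitVector V) (A : Finset V) :
    Matrix ({v // v ∈ A} → Fin 2) ({v // v ∈ A} → Fin 2) ℂ :=
  partialTraceCompl A (densityMatrix ψ)

/-- A density matrix is maximally mixed if it is proportional to the identity. -/
def IsMaximallyMixed {ι : Type*} [DecidableEq ι] (ρ : Matrix ι ι ℂ) : Prop :=
  ∃ c : ℂ, ρ = c • (1 : Matrix ι ι ℂ)

/-- `|ψ⟩` is `k`-uniform if all its marginals on `k` qubits are maximally mixed. -/
def IsUniformState (k : ℕ) (ψ : QubitVector V) : Prop :=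
  ∀ A : Finset V, A.card = k → IsMaximallyMixed (marginal ψ A)

end States

end

set_option linter.unusedSectionVars false

/-! ### Amplitudes of the graph state -/

section Amplitudes

variable {V : Type*} [Fintype V] [DecidableEq V]

/-! Up to normalization, the amplitude of the graph state at `x` is the sign `graphSign G x`, so the
entry of a marginal at `a`, `b` is a nonzero multiple of a sum over `c` of products of two signs.
Flipping qubit `u` multiplies the sign by `neighborSign G u` (`graphSign_flip`).

Let `A = {v, w}`. If some `u` outside `A` is adjacent to an odd number of the vertices where `a` and
`b` differ, flipping `u` pairs the terms with opposite values and the entry vanishes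
(`sum_graphSign_glue_eq_zero`). The difference sets `{v}`, `{w}`, `{v, w}` thus require an outside
neighbour of `v`, one of `w`, and an outside vertex adjacent to exactly one of them. If one of these
is missing, a suitable pair `a ≠ b` has a sign ratio independent of `c`, so that entry is nonzero.
In a connected graph the three ways to fail make up the foliage relation (`foliageRel_iff_cases`);
the global claims follow by quantifying over pairs. -/

/-- The sign `(-1) ^ (x_v x_w)` attached to a pair `vw`. -/
def edgeSign (x : V → Fin 2) : Sym2 V → ℂ :=
  Sym2.lift ⟨fun v w => (-1 : ℂ) ^ ((x v : ℕ) * (x w : ℕ)), fun v w => by simp only [mul_comm]⟩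

/-- The sign of the amplitude of the graph state at the basis vector `x`. -/
def graphSign (G : SimpleGraph V) [DecidableRel G.Adj] (x : V → Fin 2) : ℂ :=
  ∏ e ∈ G.edgeFinset, edgeSign x e

/-- The sign by which the amplitude changes when the qubit `u` is flipped. -/
def neighborSign (G : SimpleGraph V) [DecidableRel G.Adj] (u : V) (x : V → Fin 2) : ℂ :=
  ∏ t, if G.Adj u t then (-1 : ℂ) ^ (x t : ℕ) else 1

theorem controlledZEdge_eq_diagonal (e : Sym2 V) :
    controlledZEdge e = Matrix.diagonalRingHom (V → Fin 2) ℂ (fun x => edgeSign x e) := by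
  induction e using Sym2.ind with
  | _ a b => rfl

theorem graphState_apply (G : SimpleGraph V) [DecidableRel G.Adj] (x : V → Fin 2) :
    graphState G x = ((1 / Real.sqrt 2 : ℝ) : ℂ) ^ Fintype.card V * graphSign G x := by
  have h1 : G.edgeFinset.noncommProd controlledZEdge
      (fun e _ f _ _ => controlledZEdge_commute e f) =
      Matrix.diagonal (fun x => graphSign G x) := by
    refine (Finset.noncommProd_congr rfl (fun e _ => controlledZEdge_eq_diagonal e) _).trans ?_
    -- Diagonal matrices are the image of a commutative ring of functions, so the noncommutative
    -- product becomes a pointwise one.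
    rw [← Finset.map_noncommProd G.edgeFinset (fun e x => edgeSign x e)
        (fun _ _ _ _ _ => Commute.all _ _) (Matrix.diagonalRingHom (V → Fin 2) ℂ),
      Finset.noncommProd_eq_prod]
    change Matrix.diagonal _ = _
    congr 1
    ext x
    simp [graphSign]
  have h2 : ∀ i : Fin 2, ketPlus i = ((1 / Real.sqrt 2 : ℝ) : ℂ) := by
    intro i
    fin_cases i <;> simp [ketPlus]
  rw [graphState, h1, Matrix.mulVec_diagonal, tensorPow, Finset.prod_congr rfl fun v _ => h2 (x v),
    Finset.prod_const, Finset.card_univ, mul_comm]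

theorem edgeSign_eq_one_or (x : V → Fin 2) (e : Sym2 V) : edgeSign x e = 1 ∨ edgeSign x e = -1 := by
  induction e using Sym2.ind with
  | _ a b => exact neg_one_pow_eq_or ℂ _

theorem graphSign_eq_one_or (G : SimpleGraph V) [DecidableRel G.Adj] (x : V → Fin 2) :
    graphSign G x = 1 ∨ graphSign G x = -1 := by
  refine Finset.prod_induction _ (fun z : ℂ => z = 1 ∨ z = -1) ?_ (Or.inl rfl)
    (fun e _ => edgeSign_eq_one_or x e)
  rintro a b (rfl | rfl) (rfl | rfl) <;> simp

theorem graphSign_mul_self (G : SimpleGraph V) [DecidableRel G.Adj] (x : V → Fin 2) :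
    graphSign G x * graphSign G x = 1 := by
  rcases graphSign_eq_one_or G x with h | h <;> simp [h]

theorem star_graphSign (G : SimpleGraph V) [DecidableRel G.Adj] (x : V → Fin 2) :
    star (graphSign G x) = graphSign G x := by
  rcases graphSign_eq_one_or G x with h | h <;> simp [h]

/-- Only edges at `u` see the change: their signs are all `1` when `u` carries `0`, and `(-1) ^ x t`
when it carries `1`. -/
theorem graphSign_update_one (G : SimpleGraph V) [DecidableRel G.Adj] (x : V → Fin 2) (u : V) :
    graphSign G (Function.update x u 1) =
      graphSign G (Function.update x u 0) * neighborSign G u x := by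
  have hinc : G.incidenceFinset u ⊆ G.edgeFinset := G.incidenceFinset_subset u
  have himg : G.incidenceFinset u = (G.neighborFinset u).image (fun t => s(u, t)) := by
    ext e
    induction e using Sym2.ind with
    | _ a b =>
      simp only [SimpleGraph.mem_incidenceFinset, SimpleGraph.mk'_mem_incidenceSet_iff,
        Finset.mem_image, SimpleGraph.mem_neighborFinset, Sym2.eq_iff]
      constructor
      · rintro ⟨h, rfl | rfl⟩
        · exact ⟨b, h, by simp⟩
        · exact ⟨a, h.symm, by simp⟩
      · rintro ⟨t, h, ⟨rfl, rfl⟩ | ⟨rfl, rfl⟩⟩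
        · exact ⟨h, by simp⟩
        · exact ⟨h.symm, by simp⟩
  have hprod : ∀ y : V → Fin 2, ∏ e ∈ G.incidenceFinset u, edgeSign y e =
      ∏ t ∈ G.neighborFinset u, (-1 : ℂ) ^ ((y u : ℕ) * (y t : ℕ)) := by
    intro y
    rw [himg, Finset.prod_image]
    · rfl
    · intro a _ b _ h
      exact Sym2.congr_right.1 h
  have hrest : ∏ e ∈ G.edgeFinset \ G.incidenceFinset u, edgeSign (Function.update x u 1) e =
      ∏ e ∈ G.edgeFinset \ G.incidenceFinset u, edgeSign (Function.update x u 0) e := by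
    refine Finset.prod_congr rfl fun e he => ?_
    induction e using Sym2.ind with
    | _ a b =>
      simp only [Finset.mem_sdiff, SimpleGraph.mem_edgeFinset, SimpleGraph.mem_edgeSet,
        SimpleGraph.mem_incidenceFinset, SimpleGraph.mk'_mem_incidenceSet_iff, not_and, not_or] at he
      obtain ⟨ha, hb⟩ := he.2 he.1
      simp [edgeSign, Function.update_of_ne (Ne.symm ha), Function.update_of_ne (Ne.symm hb)]
  have hN : neighborSign G u x = ∏ t ∈ G.neighborFinset u, (-1 : ℂ) ^ (x t : ℕ) := by
    rw [neighborSign, ← Finset.prod_filter, SimpleGraph.neighborFinset_eq_filter]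
  rw [graphSign, graphSign, ← Finset.prod_sdiff hinc, ← Finset.prod_sdiff hinc, hrest, hprod,
    hprod, hN, mul_assoc]
  congr 1
  rw [← Finset.prod_mul_distrib]
  refine Finset.prod_congr rfl fun t ht => ?_
  have : t ≠ u := ((SimpleGraph.mem_neighborFinset _ _ _).1 ht).ne'
  simp [Function.update_of_ne this]

theorem neighborSign_mul_self (G : SimpleGraph V) [DecidableRel G.Adj] (u : V) (x : V → Fin 2) :
    neighborSign G u x * neighborSign G u x = 1 := by
  rw [neighborSign, ← Finset.prod_mul_distrib]
  refine Finset.prod_eq_one fun t _ => ?_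
  split_ifs <;> simp [← mul_pow]

theorem graphSign_flip (G : SimpleGraph V) [DecidableRel G.Adj] (x : V → Fin 2) (u : V) :
    graphSign G (Function.update x u (x u + 1)) = graphSign G x * neighborSign G u x := by
  have h := graphSign_update_one G x u
  rcases (by omega : x u = 0 ∨ x u = 1) with h0 | h0
  · have e : Function.update x u 0 = x := by rw [← h0, Function.update_eq_self]
    rw [e] at h
    simpa [h0] using h
  · have e : Function.update x u 1 = x := by rw [← h0, Function.update_eq_self]
    rw [e] at h
    rw [h0, h, mul_assoc, neighborSign_mul_self]
    simp

/-- Off the pair each factor is a squared sign, so only `v` and `w` can contribute. -/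
theorem neighborSign_mul_of_eq_off_pair (G : SimpleGraph V) [DecidableRel G.Adj] (u : V)
    {v w : V} (hvw : v ≠ w) {x y : V → Fin 2} (h : ∀ t, t ≠ v → t ≠ w → x t = y t) :
    neighborSign G u x * neighborSign G u y =
      (if G.Adj u v then (-1 : ℂ) ^ ((x v : ℕ) + (y v : ℕ)) else 1) *
        (if G.Adj u w then (-1 : ℂ) ^ ((x w : ℕ) + (y w : ℕ)) else 1) := by
  rw [neighborSign, neighborSign, ← Finset.prod_mul_distrib,
    ← Finset.prod_subset (Finset.subset_univ {v, w}), Finset.prod_pair hvw]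
  · congr 1 <;> split_ifs <;> simp [pow_add]
  · intro t _ ht
    simp only [Finset.mem_insert, Finset.mem_singleton, not_or] at ht
    rw [h t ht.1 ht.2]
    split_ifs <;> simp [← mul_pow]

end Amplitudes

/-! ### Two-qubit marginals of the graph state -/

section Marginals

variable {V : Type*} [Fintype V] [DecidableEq V] (G : SimpleGraph V) [DecidableRel G.Adj]

theorem marginal_graphState_apply (A : Finset V) (a b : {v // v ∈ A} → Fin 2) :
    marginal (graphState G) A a b =
      (((1 / Real.sqrt 2 : ℝ) : ℂ) ^ Fintype.card V) ^ 2 *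
        ∑ c : {v // v ∉ A} → Fin 2, graphSign G (glue A a c) * graphSign G (glue A b c) := by
  rw [marginal, partialTraceCompl, Matrix.of_apply, Finset.mul_sum]
  refine Finset.sum_congr rfl fun c _ => ?_
  rw [densityMatrix, Matrix.vecMulVec_apply, Pi.star_apply, graphState_apply, graphState_apply,
    star_mul', star_graphSign, star_pow]
  rw [show star ((1 / Real.sqrt 2 : ℝ) : ℂ) = ((1 / Real.sqrt 2 : ℝ) : ℂ) from Complex.conj_ofReal _]
  ring

theorem normalization_ne_zero :
    (((1 / Real.sqrt 2 : ℝ) : ℂ) ^ Fintype.card V) ^ 2 ≠ 0 := by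
  refine pow_ne_zero _ (pow_ne_zero _ (Complex.ofReal_ne_zero.2 ?_))
  positivity

theorem glue_of_mem (A : Finset V) (a : {v // v ∈ A} → Fin 2) (c : {v // v ∉ A} → Fin 2) {t : V}
    (h : t ∈ A) : glue A a c t = a ⟨t, h⟩ := dif_pos h

theorem glue_of_notMem (A : Finset V) (a : {v // v ∈ A} → Fin 2) (c : {v // v ∉ A} → Fin 2)
    {t : V} (h : t ∉ A) : glue A a c t = c ⟨t, h⟩ := dif_neg h

theorem glue_update_right (A : Finset V) (a : {v // v ∈ A} → Fin 2) (c : {v // v ∉ A} → Fin 2)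
    (u : {v // v ∉ A}) (i : Fin 2) :
    glue A a (Function.update c u i) = Function.update (glue A a c) u i := by
  ext t
  by_cases ht : t ∈ A
  · have : t ≠ u := fun h => u.2 (h ▸ ht)
    rw [Function.update_of_ne this, glue_of_mem _ _ _ ht, glue_of_mem _ _ _ ht]
  · rw [glue_of_notMem _ _ _ ht]
    by_cases h : t = u
    · subst h; simp
    · rw [Function.update_of_ne h, Function.update_of_ne (fun h' => h (congrArg Subtype.val h')),
        glue_of_notMem _ _ _ ht]

/-- Reindexing by the flip of `u` negates every term, so the sum equals its own negative. -/
theorem sum_graphSign_glue_eq_zero {A : Finset V} {a b : {v // v ∈ A} → Fin 2} (u : {v // v ∉ A})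
    (h : ∀ c, neighborSign G u (glue A a c) * neighborSign G u (glue A b c) = -1) :
    ∑ c : {v // v ∉ A} → Fin 2, graphSign G (glue A a c) * graphSign G (glue A b c) = 0 := by
  have hinv : Function.Involutive
      (fun c : {v // v ∉ A} → Fin 2 => Function.update c u (c u + 1)) := by
    intro c
    have : c u + 1 + 1 = c u := by omega
    simp [this]
  have hsum := Equiv.sum_comp (hinv.toPerm _)
    (fun c => graphSign G (glue A a c) * graphSign G (glue A b c))
  have hneg : ∀ c : {v // v ∉ A} → Fin 2,
      graphSign G (glue A a (hinv.toPerm _ c)) * graphSign G (glue A b (hinv.toPerm _ c)) =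
        -(graphSign G (glue A a c) * graphSign G (glue A b c)) := by
    intro c
    have hf : ∀ d : {v // v ∈ A} → Fin 2, graphSign G (glue A d (hinv.toPerm _ c)) =
        graphSign G (glue A d c) * neighborSign G u (glue A d c) := by
      intro d
      rw [← graphSign_flip, Function.Involutive.coe_toPerm, glue_update_right,
        glue_of_notMem A d c u.2]
    rw [hf, hf]
    linear_combination graphSign G (glue A a c) * graphSign G (glue A b c) * h c
  rw [Finset.sum_congr rfl fun c _ => hneg c, Finset.sum_neg_distrib] at hsum
  exact self_eq_neg.1 hsum.symm

theorem isMaximallyMixed_marginal_graphState {v w : V} (hvw : v ≠ w)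
    (h1 : ∃ u, u ≠ v ∧ u ≠ w ∧ G.Adj v u) (h2 : ∃ u, u ≠ v ∧ u ≠ w ∧ G.Adj w u)
    (h3 : ∃ u, u ≠ v ∧ u ≠ w ∧ ¬ (G.Adj v u ↔ G.Adj w u)) :
    IsMaximallyMixed (marginal (graphState G) {v, w}) := by
  -- On the diagonal every summand is a squared sign, so the sum counts the assignments `c`.
  refine ⟨(((1 / Real.sqrt 2 : ℝ) : ℂ) ^ Fintype.card V) ^ 2 *
    Fintype.card ({t // t ∉ ({v, w} : Finset V)} → Fin 2), ?_⟩
  ext a b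
  rw [marginal_graphState_apply, Matrix.smul_apply, smul_eq_mul, mul_assoc]
  congr 1
  by_cases hab : a = b
  · subst hab
    simp [graphSign_mul_self]
  rw [Matrix.one_apply_ne hab, mul_zero]
  have hv : v ∈ ({v, w} : Finset V) := by simp
  have hw : w ∈ ({v, w} : Finset V) := by simp
  have hne : a ⟨v, hv⟩ ≠ b ⟨v, hv⟩ ∨ a ⟨w, hw⟩ ≠ b ⟨w, hw⟩ := by
    by_contra! hc
    refine hab (funext fun ⟨t, ht⟩ => ?_)
    rcases Finset.mem_insert.1 ht with rfl | ht'
    · exact hc.1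
    · obtain rfl := Finset.mem_singleton.1 ht'
      exact hc.2
  have key : ∀ i j : Fin 2, (-1 : ℂ) ^ ((i : ℕ) + (j : ℕ)) = if i = j then 1 else -1 := by
    intro i j
    fin_cases i <;> fin_cases j <;> simp
  -- The vertex to flip depends on where `a` and `b` differ: `h2` serves `{w}`, `h1` serves `{v}`,
  -- and `h3` serves both.
  obtain ⟨u, huv, huw, hu⟩ : ∃ u, u ≠ v ∧ u ≠ w ∧
      (if G.Adj u v then (if a ⟨v, hv⟩ = b ⟨v, hv⟩ then 1 else -1) else 1 : ℂ) *
        (if G.Adj u w then (if a ⟨w, hw⟩ = b ⟨w, hw⟩ then 1 else -1) else 1) = -1 := by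
    by_cases hav : a ⟨v, hv⟩ = b ⟨v, hv⟩
    · obtain ⟨u, huv, huw, hu⟩ := h2
      have haw : a ⟨w, hw⟩ ≠ b ⟨w, hw⟩ := hne.resolve_left (not_not.2 hav)
      exact ⟨u, huv, huw, by simp [hav, haw, hu.symm]⟩
    by_cases haw : a ⟨w, hw⟩ = b ⟨w, hw⟩
    · obtain ⟨u, huv, huw, hu⟩ := h1
      exact ⟨u, huv, huw, by simp [hav, haw, hu.symm]⟩
    obtain ⟨u, huv, huw, hu⟩ := h3
    refine ⟨u, huv, huw, ?_⟩
    rw [G.adj_comm v, G.adj_comm w] at hu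
    by_cases k : G.Adj u v <;> by_cases l : G.Adj u w <;> simp_all
  refine sum_graphSign_glue_eq_zero G ⟨u, by simp [huv, huw]⟩ fun c => ?_
  rw [neighborSign_mul_of_eq_off_pair G u hvw, glue_of_mem _ _ _ hv, glue_of_mem _ _ _ hv,
    glue_of_mem _ _ _ hw, glue_of_mem _ _ _ hw, key, key, hu]
  intro t htv htw
  have ht : t ∉ ({v, w} : Finset V) := by simp [htv, htw]
  rw [glue_of_notMem _ _ _ ht, glue_of_notMem _ _ _ ht]

/-- An off-diagonal entry of the marginal does not vanish if the signs are perfectly correlated. -/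
theorem not_isMaximallyMixed_of_graphSign_eq {A : Finset V} {a b : {v // v ∈ A} → Fin 2}
    (hab : a ≠ b) {ε : ℂ} (hε : ε ≠ 0)
    (h : ∀ c, graphSign G (glue A b c) = graphSign G (glue A a c) * ε) :
    ¬ IsMaximallyMixed (marginal (graphState G) A) := by
  rintro ⟨r, hr⟩
  have := congrFun (congrFun hr a) b
  rw [marginal_graphState_apply, Matrix.smul_apply, Matrix.one_apply_ne hab, smul_zero] at this
  refine mul_ne_zero normalization_ne_zero ?_ this
  simp [h, ← mul_assoc, graphSign_mul_self, hε]

theorem glue_update_left (A : Finset V) (a : {v // v ∈ A} → Fin 2) (c : {v // v ∉ A} → Fin 2)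
    (u : {v // v ∈ A}) (i : Fin 2) :
    glue A (Function.update a u i) c = Function.update (glue A a c) u i := by
  ext t
  by_cases ht : t ∈ A
  · rw [glue_of_mem _ _ _ ht]
    by_cases h : t = u
    · subst h; simp
    · rw [Function.update_of_ne h, Function.update_of_ne (fun h' => h (congrArg Subtype.val h')),
        glue_of_mem _ _ _ ht]
  · have : t ≠ u := fun h => ht (h ▸ u.2)
    rw [Function.update_of_ne this, glue_of_notMem _ _ _ ht, glue_of_notMem _ _ _ ht]

/-- All neighbours of `v` lie in `A`, where the zero assignment gives them `0`; flipping `v` from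
there leaves the sign unchanged for every `c`. -/
theorem not_isMaximallyMixed_of_forall_not_adj {A : Finset V} {v : V} (hv : v ∈ A)
    (h : ∀ u ∉ A, ¬ G.Adj v u) : ¬ IsMaximallyMixed (marginal (graphState G) A) := by
  refine not_isMaximallyMixed_of_graphSign_eq G (a := 0) (b := Function.update 0 ⟨v, hv⟩ 1)
    (fun e => ?_) one_ne_zero fun c => ?_
  · simpa using congrFun e ⟨v, hv⟩
  · have hf := graphSign_flip G (glue A 0 c) v
    rw [glue_of_mem A _ _ hv] at hf
    rw [glue_update_left]
    simp only [Pi.zero_apply, zero_add] at hf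
    rw [hf]
    congr 1
    refine Finset.prod_eq_one fun t _ => ?_
    split_ifs with ht
    · have : t ∈ A := by by_contra hA; exact h t hA ht
      rw [glue_of_mem A _ _ this]; simp
    · rfl

/-- Flipping both twins from `0` to `1` lets each outside neighbour contribute twice, which cancels;
only a possible edge `vw` is left, whence the value of `ε`. -/
theorem not_isMaximallyMixed_of_twins {v w : V} (hvw : v ≠ w)
    (h : ∀ u, u ≠ v → u ≠ w → (G.Adj v u ↔ G.Adj w u)) :
    ¬ IsMaximallyMixed (marginal (graphState G) {v, w}) := by
  have hv : v ∈ ({v, w} : Finset V) := by simp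
  have hw : w ∈ ({v, w} : Finset V) := by simp
  refine not_isMaximallyMixed_of_graphSign_eq G (a := 0)
    (b := Function.update (Function.update 0 ⟨v, hv⟩ 1) ⟨w, hw⟩ 1)
    (ε := if G.Adj v w then -1 else 1) (fun e => ?_) (by split_ifs <;> simp) fun c => ?_
  · simpa using congrFun e ⟨w, hw⟩
  · set x := glue {v, w} 0 c with hx
    have xv : x v = 0 := glue_of_mem _ _ _ hv
    have xw : x w = 0 := glue_of_mem _ _ _ hw
    have f1 := graphSign_flip G x v
    have f2 := graphSign_flip G (Function.update x v 1) w
    rw [Function.update_of_ne hvw.symm, xw] at f2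
    rw [xv] at f1
    simp only [zero_add] at f1 f2
    rw [glue_update_left, glue_update_left, f2, f1, mul_assoc]
    congr 1
    -- The factor at `v` survives because `v` is already flipped when `w` is.
    rw [neighborSign, neighborSign, ← Finset.prod_mul_distrib, Finset.prod_eq_single v]
    · simp [G.adj_comm w v]
    · intro t _ htv
      rw [Function.update_of_ne htv]
      by_cases htw : t = w
      · subst htw; simp [xw]
      · simp only [h t htv htw]
        split_ifs <;> simp [← mul_pow]
    · simp

end Marginals

/-! ### The foliage partition -/

section FoliagePartition

variable {V : Type*} (G : SimpleGraph V) [DecidableRel G.Adj]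

theorem foliageRel_iff_cases (hG : G.Connected) {v w : V} :
    FoliageRel G v w ↔ (∀ u, u ≠ v → u ≠ w → (G.Adj v u ↔ G.Adj w u)) ∨
      (∀ u, u ≠ v → u ≠ w → ¬ G.Adj v u) ∨ (∀ u, u ≠ v → u ≠ w → ¬ G.Adj w u) := by
  refine ⟨foliageRel_cases G, fun h => ⟨hG.preconnected v w, fun u₁ u₂ h1 h2 h3 h4 => ?_⟩⟩
  simp only [SimpleGraph.adjMatrix_apply]
  rcases h with h | h | h
  · simp only [h u₁ h1 h2, h u₂ h3 h4, mul_comm]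
  · simp [h u₁ h1 h2, h u₂ h3 h4]
  · simp [h u₁ h1 h2, h u₂ h3 h4]

theorem isMaximallyMixed_pair_iff [Fintype V] [DecidableEq V] (hG : G.Connected) {v w : V}
    (hvw : v ≠ w) :
    IsMaximallyMixed (marginal (graphState G) {v, w}) ↔ ¬ FoliageRel G v w := by
  rw [foliageRel_iff_cases G hG]
  constructor
  · rintro h (k | k | k)
    · exact not_isMaximallyMixed_of_twins G hvw k h
    · exact not_isMaximallyMixed_of_forall_not_adj G (v := v) (by simp)
        (fun u hu => have := not_or.1 (mt Finset.mem_insert.2 hu)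
          k u this.1 (mt Finset.mem_singleton.2 this.2)) h
    · exact not_isMaximallyMixed_of_forall_not_adj G (v := w) (by simp)
        (fun u hu => have := not_or.1 (mt Finset.mem_insert.2 hu)
          k u this.1 (mt Finset.mem_singleton.2 this.2)) h
  · intro h
    simp only [not_or, not_forall, not_not, exists_prop] at h
    exact isMaximallyMixed_marginal_graphState G hvw h.2.1 h.2.2 h.1

/-- The part of the foliage partition that contains `v`. -/
def foliagePart (v : V) : Set V := {x | FoliageRel G x v}

theorem foliagePartition_eq_range : foliagePartition G = Set.range (foliagePart G) := by
  ext P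
  constructor
  · rintro ⟨v, rfl⟩; exact ⟨v, rfl⟩
  · rintro ⟨v, rfl⟩; exact ⟨v, rfl⟩

theorem foliagePart_eq_iff {v w : V} : foliagePart G v = foliagePart G w ↔ FoliageRel G v w := by
  have E := foliageRel_equivalence G
  constructor
  · intro h
    have : v ∈ foliagePart G v := E.refl v
    rwa [h] at this
  · intro h
    ext x
    exact ⟨fun hx => E.trans hx h, fun hx => E.trans hx (E.symm h)⟩

theorem exists_parts_ne_iff {v w : V} :
    (∃ P ∈ foliagePartition G, ∃ Q ∈ foliagePartition G, P ≠ Q ∧ v ∈ P ∧ w ∈ Q) ↔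
      ¬ FoliageRel G v w := by
  have E := foliageRel_equivalence G
  rw [foliagePartition_eq_range, ← foliagePart_eq_iff]
  constructor
  · rintro ⟨_, ⟨p, rfl⟩, _, ⟨q, rfl⟩, hne, hv, hw⟩ h
    exact hne (((foliagePart_eq_iff G).2 hv).symm.trans (h.trans ((foliagePart_eq_iff G).2 hw)))
  · exact fun h => ⟨_, ⟨v, rfl⟩, _, ⟨w, rfl⟩, h, E.refl v, E.refl w⟩

theorem foliageTrivial_iff : FoliageTrivial G ↔ ∀ v w, v ≠ w → ¬ FoliageRel G v w := by
  have E := foliageRel_equivalence G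
  rw [FoliageTrivial, foliagePartition_eq_range]
  constructor
  · intro h v w hvw hr
    obtain ⟨t, ht⟩ : foliagePart G w ∈ Set.range (fun v : V => ({v} : Set V)) := h ▸ ⟨w, rfl⟩
    have h1 : v ∈ foliagePart G w := hr
    have h2 : w ∈ foliagePart G w := E.refl w
    rw [← ht] at h1 h2
    exact hvw (h1.trans h2.symm)
  · intro h
    congr 1
    ext v x
    refine ⟨fun hx => ?_, ?_⟩
    · by_contra hne
      exact h x v hne hx
    · rintro rfl
      exact E.refl x

/-- `foliagePart` maps `V` onto the partition, so equal cardinality means injectivity. -/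
theorem ncard_foliagePartition_eq_iff [Fintype V] :
    (foliagePartition G).ncard = Fintype.card V ↔ ∀ v w, v ≠ w → ¬ FoliageRel G v w := by
  classical
  rw [foliagePartition_eq_range, ← Set.image_univ, ← Finset.coe_univ, ← Finset.coe_image,
    Set.ncard_coe_finset, ← Finset.card_univ, Finset.card_image_iff, Finset.coe_univ,
    Set.injOn_univ]
  simp only [← foliagePart_eq_iff]
  exact ⟨fun h v w hvw hr => hvw (h hr), fun h v w hr => by_contra fun hvw => h v w hvw hr⟩

theorem isUniformState_two_iff [Fintype V] [DecidableEq V] (hG : G.Connected) :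
    IsUniformState 2 (graphState G) ↔ ∀ v w, v ≠ w → ¬ FoliageRel G v w := by
  constructor
  · exact fun h v w hvw => (isMaximallyMixed_pair_iff G hG hvw).1 (h _ (Finset.card_pair hvw))
  · intro h A hA
    obtain ⟨v, w, hvw, rfl⟩ := Finset.card_eq_two.1 hA
    exact (isMaximallyMixed_pair_iff G hG hvw).2 (h v w hvw)

end FoliagePartition

theorem mainTheorem3 {V : Type*} [Fintype V] [DecidableEq V]
    (G : SimpleGraph V) [DecidableRel G.Adj] (hG : G.Connected) :
    (∀ v w : V, v ≠ w →
      (IsMaximallyMixed (marginal (graphState G) {v, w}) ↔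
        ∃ P ∈ foliagePartition G, ∃ Q ∈ foliagePartition G, P ≠ Q ∧ v ∈ P ∧ w ∈ Q)) ∧
    (IsUniformState 2 (graphState G) ↔ FoliageTrivial G) ∧
    (IsUniformState 2 (graphState G) ↔ (foliagePartition G).ncard = Fintype.card V) :=
  ⟨fun _ _ hvw => (isMaximallyMixed_pair_iff G hG hvw).trans (exists_parts_ne_iff G).symm,
    (isUniformState_two_iff G hG).trans (foliageTrivial_iff G).symm,
    (isUniformState_two_iff G hG).trans (ncard_foliagePartition_eq_iff G).symm⟩
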